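/- Let $G$ be a compact Hausdorff topological group with normalized Haar measure $\mu$, and let $E$ be a non-zero operator space, i.e. a non-zero closed subspace of $\mathcal B(\mathcal H)$ for a complex Hilbert space $\mathcal H$, with $M_n(E)$ normed as a subspace of $\mathcal B(\ell^2_n(\mathcal H))$. Let $\widehat G$ be the set of unitary equivalence classes of continuous irreducible unitary representations $\pi: G\to U(\mathbb C^{d_\pi})$ of $G$, with one representation fixed in each class. For $f$ in the Bochner space $L^1_E(G)$ put $$\widehat f(\pi)=\int_G f(g)\,\pi(g)^{*}\,d\mu(g)\in M_{d_\pi}(E),\qquad \pi\in\widehat G .$$ Give $L^1(G)$ its natural operator space structure, as a subspace of the operator space dual of $L^\infty(G)$ (so $M_n(L^1(G))\subset cb(L^\infty(G),M_n)$ isometrically). Give $L^1_E(G)$ the operator space structure of the completion of $L^1(G)\otimes E$ for the operator space projective tensor norms $\|u\|_n=\inf\|\alpha\|\|v\|\|w\|\|\beta\|$, the infimum being over all factorizations $u=\alpha(v\otimes w)\beta$ with $v\in M_p(L^1(G))$, $w\in M_q(E)$ and scalar matrices $\alpha\in M_{n,pq}$, $\beta\in M_{pq,n}$. Let $$\mathcal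 L^\infty_E(\widehat G)=\Big\{(A^\pi)_{\pi}\in\prod_{\pi\in\widehat G}M_{d_\pi}(E):\ \sup_\pi\|A^\pi\|_{M_{d_\pi}(E)}<\infty\Big\},$$ with the matrix norms $\|(A_{ij})\|_{M_n(\mathcal L^\infty_E(\widehat G))}=\sup_\pi\|(A^\pi_{ij})\|_{M_{nd_\pi}(E)}$. Then $E$ has Fourier type $1$ with respect to $G$, with constant $\mathcal C^1_1(E,G)=1$. That is, the map $f\otimes e\mapsto(\widehat f(\pi)\otimes e)_{\pi}$ on $L^1(G)\otimes E$ has exactly one completely bounded linear extension $\Lambda:L^1_E(G)\to\mathcal L^\infty_E(\widehat G)$; it is given by $\Lambda(f)=(\widehat f(\pi))_{\pi}$ for all $f\in L^1_E(G)$, and $$\|\Lambda\|_{cb}=\sup_{n\ge1}\big\|\mathrm{id}_{M_n}\otimes\Lambda: M_n(L^1_E(G))\to M_n(\mathcal L^\infty_E(\widehat G))\big\|=1 .$$ -/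

import Mathlib

open MeasureTheory Filter Topology
open scoped ENNReal TensorProduct

noncomputable section

namespace FourierType

/-! ### Matrix norms, complete boundedness -/

/-- A family of (extended) norms on the matrix spaces `M_n(V)`. -/
abbrev MatrixNorms (V : Type*) := (n : ℕ) → Matrix (Fin n) (Fin n) V → ℝ≥0∞

/-- The completely bounded norm `‖u‖_cb = sup_n ‖id_{M_n} ⊗ u‖`, where `V` and `W` carry the
matrix norms `ρ` and `σ`. -/
def cbNorm {V W : Type*} [AddCommGroup V] [Module ℂ V] [AddCommGroup W] [Module ℂ W]
    (ρ : MatrixNorms V) (σ : MatrixNorms W) (u : V →ₗ[ℂ] W) : ℝ≥0∞ :=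
  ⨆ (n : ℕ) (x : Matrix (Fin n) (Fin n) V) (_ : ρ n x ≤ 1), σ n (x.map u)

/-- The operator norm of a (rectangular) scalar matrix, as a map between `ℓ²` spaces. -/
def scalarNorm {m n : Type*} [Fintype m] [Fintype n] [DecidableEq n] (a : Matrix m n ℂ) : ℝ≥0∞ :=
  ‖LinearMap.toContinuousLinearMap (Matrix.toEuclideanLin a)‖ₑ

/-- The operator space `M_n = B(ℓ²(n))`: the matrix norms come from `M_m(M_n) = M_{mn}`. -/
def scalarMatrixNorms (n : ℕ) : MatrixNorms (Matrix (Fin n) (Fin n) ℂ) :=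
  fun m x => scalarNorm (Matrix.comp (Fin m) (Fin m) (Fin n) (Fin n) ℂ x)

/-! ### Concrete operator spaces

An operator space is a Banach space `E` together with an isometric embedding `j : E → B(H)`, that
is, a closed subspace of `B(H)`. -/

section OperatorSpace

section Block

variable {F : Type*} [NormedAddCommGroup F] [NormedSpace ℂ F] {ι : Type*} [Fintype ι]

/-- The operator on `ℓ²_F(ι)` given by a matrix of operators on `F`. -/
def blockOp (a : Matrix ι ι (F →L[ℂ] F)) :
    PiLp 2 (fun _ : ι => F) →L[ℂ] PiLp 2 (fun _ : ι => F) :=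
  (PiLp.continuousLinearEquiv 2 ℂ (fun _ : ι => F)).symm.toContinuousLinearMap ∘L
    (ContinuousLinearMap.pi fun i => ∑ k, a i k ∘L ContinuousLinearMap.proj k) ∘L
      (PiLp.continuousLinearEquiv 2 ℂ (fun _ : ι => F)).toContinuousLinearMap

theorem blockOp_apply (a : Matrix ι ι (F →L[ℂ] F)) (h : PiLp 2 (fun _ : ι => F)) (i : ι) :
    blockOp a h i = ∑ k, a i k (h k) := by
  simp [blockOp]

/-- The norm of a matrix of operators on `F`, as an operator on `ℓ²_F(ι)`. -/
def blockNorm (a : Matrix ι ι (F →L[ℂ] F)) : ℝ≥0∞ := ‖blockOp a‖ₑ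

theorem blockNorm_add_le (a b : Matrix ι ι (F →L[ℂ] F)) :
    blockNorm (a + b) ≤ blockNorm a + blockNorm b := by
  have h : blockOp (a + b) = blockOp a + blockOp b := by
    ext h i
    simp [blockOp_apply, Finset.sum_add_distrib]
  rw [blockNorm, h]
  exact enorm_add_le (blockOp a) (blockOp b)

theorem blockNorm_smul (c : ℂ) (a : Matrix ι ι (F →L[ℂ] F)) :
    blockNorm (c • a) = ‖c‖ₑ * blockNorm a := by
  have h : blockOp (c • a) = c • blockOp a := by
    ext h i
    simp [blockOp_apply, Finset.smul_sum]
  rw [blockNorm, h, enorm_smul, blockNorm]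

theorem blockNorm_zero : blockNorm (0 : Matrix ι ι (F →L[ℂ] F)) = 0 := by
  simpa using blockNorm_smul (0 : ℂ) (0 : Matrix ι ι (F →L[ℂ] F))

end Block

variable {H : Type*} [NormedAddCommGroup H] [InnerProductSpace ℂ H]
  {E : Type*} [NormedAddCommGroup E] [NormedSpace ℂ E]

/-- The norm of a matrix with entries in the operator space `E ⊆ B(H)`, as an operator on
`ℓ²_H(ι)`. -/
def opMatrixNorm (j : E →ₗᵢ[ℂ] (H →L[ℂ] H)) {ι : Type*} [Fintype ι] (a : Matrix ι ι E) :
    ℝ≥0∞ :=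
  blockNorm (a.map j)

/-- The operator space structure of `E ⊆ B(H)`. -/
def spaceMatrixNorms (j : E →ₗᵢ[ℂ] (H →L[ℂ] H)) : MatrixNorms E :=
  fun _ a => opMatrixNorm j a

theorem opMatrixNorm_add_le (j : E →ₗᵢ[ℂ] (H →L[ℂ] H)) {ι : Type*} [Fintype ι]
    (a b : Matrix ι ι E) : opMatrixNorm j (a + b) ≤ opMatrixNorm j a + opMatrixNorm j b := by
  have h : (a + b).map j = a.map j + b.map j := by
    ext1 i k; simp
  rw [opMatrixNorm, h]
  exact blockNorm_add_le _ _

theorem opMatrixNorm_smul (j : E →ₗᵢ[ℂ] (H →L[ℂ] H)) {ι : Type*} [Fintype ι]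
    (c : ℂ) (a : Matrix ι ι E) : opMatrixNorm j (c • a) = ‖c‖ₑ * opMatrixNorm j a := by
  have h : (c • a).map j = c • a.map j := by
    ext1 i k; simp
  rw [opMatrixNorm, h, blockNorm_smul, opMatrixNorm]

theorem opMatrixNorm_zero (j : E →ₗᵢ[ℂ] (H →L[ℂ] H)) {ι : Type*} [Fintype ι] :
    opMatrixNorm j (0 : Matrix ι ι E) = 0 := by
  have h : (0 : Matrix ι ι E).map j = 0 := by
    ext1 i k; simp
  rw [opMatrixNorm, h, blockNorm_zero]

end OperatorSpace

/-! ### The projective tensor product -/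

/-- The operator space projective tensor norm on `M_n(V ⊗ W)`:
the infimum of `‖α‖ ‖v‖ ‖w‖ ‖β‖` over all factorizations `u = α (v ⊗ w) β` with
`v ∈ M_p(V)`, `w ∈ M_q(W)`, `α ∈ M_{n,pq}` and `β ∈ M_{pq,n}`. -/
def projMatrixNorms {V W : Type*} [AddCommGroup V] [Module ℂ V] [AddCommGroup W] [Module ℂ W]
    (ρ : MatrixNorms V) (σ : MatrixNorms W) : MatrixNorms (V ⊗[ℂ] W) :=
  fun n u =>
    ⨅ (p : ℕ) (q : ℕ) (α : Matrix (Fin n) (Fin p × Fin q) ℂ) (v : Matrix (Fin p) (Fin p) V)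
      (w : Matrix (Fin q) (Fin q) W) (β : Matrix (Fin p × Fin q) (Fin n) ℂ)
      (_ : ∀ i j, u i j = ∑ r, ∑ s, (α i r * β s j) • (v r.1 s.1 ⊗ₜ[ℂ] w r.2 s.2)),
      scalarNorm α * ρ p v * σ q w * scalarNorm β

/-! ### The operator spaces `L^∞`, `L^1` and `L^1_E` -/

section Lebesgue

variable {Ω : Type*} [MeasurableSpace Ω] (μ : Measure Ω)

/-- The operator space structure of `L^∞(Ω)`, that is `M_m(L^∞) = L^∞(Ω; M_m)`. -/
def linftyMatrixNorms : MatrixNorms (Lp ℂ ∞ μ) :=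
  fun m g => essSup (fun x => scalarNorm (Matrix.of fun k l : Fin m => g k l x)) μ

theorem integrable_mul_linfty (f : Lp ℂ 1 μ) (g : Lp ℂ ∞ μ) :
    Integrable (fun x => f x * g x) μ :=
  (L1.integrable_coeFn f).mul_of_top_left (Lp.memLp g)

/-- The pairing of a matrix `(f_ij)` over `L^1` with `L^∞`: the map `g ↦ (∫ f_ij g dμ)` from
`L^∞` to `M_n`. -/
def pairing {n : ℕ} (f : Matrix (Fin n) (Fin n) (Lp ℂ 1 μ)) :
    Lp ℂ ∞ μ →ₗ[ℂ] Matrix (Fin n) (Fin n) ℂ where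
  toFun g := Matrix.of fun i j => ∫ x, f i j x * g x ∂μ
  map_add' g h := by
    ext i j
    simp only [Matrix.of_apply, Matrix.add_apply]
    rw [← integral_add (integrable_mul_linfty μ _ _) (integrable_mul_linfty μ _ _)]
    apply integral_congr_ae
    filter_upwards [Lp.coeFn_add g h] with x hx
    rw [hx, Pi.add_apply, mul_add]
  map_smul' c g := by
    ext i j
    simp only [Matrix.of_apply, Matrix.smul_apply, RingHom.id_apply, smul_eq_mul]
    rw [← integral_const_mul]
    apply integral_congr_ae
    filter_upwards [Lp.coeFn_smul c g] with x hx
    rw [hx, Pi.smul_apply, smul_eq_mul]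
    ring

/-- The natural operator space structure of `L^1(Ω)`, as a subspace of the operator space dual
of `L^∞(Ω)`: the norm of `M_n(L^1)` is that of `cb(L^∞, M_n)`. -/
def loneMatrixNorms : MatrixNorms (Lp ℂ 1 μ) :=
  fun n f => cbNorm (linftyMatrixNorms μ) (scalarMatrixNorms n) (pairing μ f)

section Vector

variable {V : Type*} [NormedAddCommGroup V] [NormedSpace ℂ V]

/-- The inclusion `L^1(Ω) ⊗ V → L^1_V(Ω)` into the Bochner space, `f ⊗ v ↦ f(·) v`. -/
def tensorToLp : Lp ℂ 1 μ ⊗[ℂ] V →ₗ[ℂ] Lp V 1 μ :=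
  TensorProduct.lift <| LinearMap.mk₂ ℂ
    (fun f v => (ContinuousLinearMap.toSpanSingleton ℂ v).compLp f)
    (fun f g v => ((ContinuousLinearMap.toSpanSingleton ℂ v).compLpₗ 1 μ).map_add f g)
    (fun c f v => ((ContinuousLinearMap.toSpanSingleton ℂ v).compLpₗ 1 μ).map_smul c f)
    (fun f v w => by
      rw [ContinuousLinearMap.toSpanSingleton_add, ContinuousLinearMap.add_compLp])
    (fun c f v => by
      rw [ContinuousLinearMap.toSpanSingleton_smul, ContinuousLinearMap.smul_compLp])

theorem tensorToLp_tmul (f : Lp ℂ 1 μ) (v : V) :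
    tensorToLp μ (f ⊗ₜ[ℂ] v) =ᵐ[μ] fun x => f x • v := by
  have h : tensorToLp μ (f ⊗ₜ[ℂ] v) = (ContinuousLinearMap.toSpanSingleton ℂ v).compLp f := rfl
  rw [h]
  filter_upwards [(ContinuousLinearMap.toSpanSingleton ℂ v).coeFn_compLp f] with x hx
  rw [hx, ContinuousLinearMap.toSpanSingleton_apply]

end Vector

/-- The operator space structure of the Bochner space `L^1_E(Ω)`, as the completion of the
operator space projective tensor product of `L^1(Ω)` and `E`: the norm of a matrix over `L^1_E`
is the limit of the projective norms of the matrices over `L^1 ⊗ E` that converge to it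
entrywise. -/
def bochnerMatrixNorms {H : Type*} [NormedAddCommGroup H] [InnerProductSpace ℂ H]
  {E : Type*} [NormedAddCommGroup E] [NormedSpace ℂ E]
    (j : E →ₗᵢ[ℂ] (H →L[ℂ] H)) : MatrixNorms (Lp E 1 μ) :=
  fun n F => liminf (projMatrixNorms (loneMatrixNorms μ) (spaceMatrixNorms j) n)
    (comap (fun u : Matrix (Fin n) (Fin n) (Lp ℂ 1 μ ⊗[ℂ] E) => u.map (tensorToLp μ)) (𝓝 F))

end Lebesgue

/-! ### The dual object of a compact group -/

section Dual

/-- A continuous irreducible unitary representation `π : G → U(ℂ^d)`. -/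
structure IrrUnitaryRep (G : Type*) [Group G] [TopologicalSpace G] where
  deg : ℕ
  hom : G →* Matrix.unitaryGroup (Fin deg) ℂ
  continuous_hom : Continuous fun g => (hom g : Matrix (Fin deg) (Fin deg) ℂ)
  irreducible : Representation.IsIrreducible
    (((Matrix.toLinAlgEquiv' : Matrix (Fin deg) (Fin deg) ℂ ≃ₐ[ℂ] _).toAlgHom :
        Matrix (Fin deg) (Fin deg) ℂ →* Module.End ℂ (Fin deg → ℂ)).comp
      ((Matrix.unitaryGroup (Fin deg) ℂ).subtype.comp hom) :
      Representation ℂ G (Fin deg → ℂ))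

variable {G : Type*} [Group G] [TopologicalSpace G]

/-- The matrix `π(g)`. -/
def IrrUnitaryRep.mat (π : IrrUnitaryRep G) (g : G) : Matrix (Fin π.deg) (Fin π.deg) ℂ :=
  (π.hom g : Matrix (Fin π.deg) (Fin π.deg) ℂ)

variable (G) in
/-- Unitary equivalence of representations. -/
instance unitaryEquiv : Setoid (IrrUnitaryRep G) where
  r π σ := ∃ U : Matrix (Fin σ.deg) (Fin π.deg) ℂ,
    U.conjTranspose * U = 1 ∧ U * U.conjTranspose = 1 ∧ ∀ g, U * π.mat g = σ.mat g * U
  iseqv :=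
    { refl := fun π => ⟨1, by simp, by simp, by simp⟩
      symm := by
        rintro π σ ⟨U, h1, h2, h⟩
        refine ⟨U.conjTranspose, by simpa using h2, by simpa using h1, fun g => ?_⟩
        calc U.conjTranspose * σ.mat g
            = U.conjTranspose * (σ.mat g * U) * U.conjTranspose := by
              rw [Matrix.mul_assoc, Matrix.mul_assoc, h2, Matrix.mul_one]
          _ = (U.conjTranspose * U) * π.mat g * U.conjTranspose := by
              rw [← h, Matrix.mul_assoc U.conjTranspose U]
          _ = π.mat g * U.conjTranspose := by rw [h1, Matrix.one_mul]
      trans := by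
        rintro π σ τ ⟨U, h1, h2, h⟩ ⟨W, k1, k2, k⟩
        refine ⟨W * U, ?_, ?_, fun g => ?_⟩
        · rw [Matrix.conjTranspose_mul, Matrix.mul_assoc, ← Matrix.mul_assoc W.conjTranspose,
            k1, Matrix.one_mul, h1]
        · rw [Matrix.conjTranspose_mul, Matrix.mul_assoc, ← Matrix.mul_assoc U,
            h2, Matrix.one_mul, k2]
        · rw [Matrix.mul_assoc, h, ← Matrix.mul_assoc, k, Matrix.mul_assoc] }

variable (G) in
/-- The dual object `Ĝ`: unitary equivalence classes of irreducible unitary representations. -/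
abbrev DualObject := Quotient (unitaryEquiv G)

end Dual

/-! ### The vector-valued Fourier transform -/

section Fourier

variable {G : Type*} [Group G] [TopologicalSpace G] [IsTopologicalGroup G] [CompactSpace G]
  [MeasurableSpace G] [BorelSpace G] (μ : Measure G)

section Coefficient

variable {V : Type*} [NormedAddCommGroup V] [NormedSpace ℂ V]

/-- The Fourier coefficient `f̂(π) = ∫ f(g) π(g)^* dμ(g)`, a matrix with entries in `V`. -/
def fourierCoeff (π : IrrUnitaryRep G) (f : Lp V 1 μ) : Matrix (Fin π.deg) (Fin π.deg) V :=
  Matrix.of fun i j => ∫ g, (π.mat g).conjTranspose i j • f g ∂μ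

end Coefficient

variable {H : Type*} [NormedAddCommGroup H] [InnerProductSpace ℂ H]
  {E : Type*} [NormedAddCommGroup E] [NormedSpace ℂ E]

/-- The operator space `𝓛^∞_E(Ĝ)`: the families `A^π ∈ M_{d_π}(E)` indexed by `π ∈ Ĝ` with
`sup_π ‖A^π‖ < ∞`; here `rep` chooses a representation in each class. -/
def dualLinfty (rep : DualObject G → IrrUnitaryRep G) (j : E →ₗᵢ[ℂ] (H →L[ℂ] H)) :
    Submodule ℂ ((π : DualObject G) → Matrix (Fin (rep π).deg) (Fin (rep π).deg) E) where
  carrier := {A | ⨆ π, opMatrixNorm j (A π) < ∞}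
  zero_mem' := by
    simp [opMatrixNorm_zero]
  add_mem' := fun {A B} hA hB => by
    have hAB : (⨆ π, opMatrixNorm j (A π)) + (⨆ π, opMatrixNorm j (B π)) < ∞ :=
      ENNReal.add_lt_top.2 ⟨hA, hB⟩
    refine lt_of_le_of_lt (iSup_le fun π => ?_) hAB
    exact (opMatrixNorm_add_le j (A π) (B π)).trans
      (add_le_add (le_iSup (fun π => opMatrixNorm j (A π)) π)
        (le_iSup (fun π => opMatrixNorm j (B π)) π))
  smul_mem' := fun c A hA => by
    have hcA : ‖c‖ₑ * (⨆ π, opMatrixNorm j (A π)) < ∞ := ENNReal.mul_lt_top enorm_lt_top hA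
    refine lt_of_le_of_lt (iSup_le fun π => ?_) hcA
    rw [Pi.smul_apply, opMatrixNorm_smul]
    exact mul_le_mul_right (le_iSup (fun π => opMatrixNorm j (A π)) π) _

/-- The operator space structure of `𝓛^∞_E(Ĝ)`: the norm on `M_n(𝓛^∞_E(Ĝ))` is
`sup_π ‖(A_ij^π)‖` in `M_n(M_{d_π}(E)) = M_{n d_π}(E)`. -/
def dualLinftyMatrixNorms (rep : DualObject G → IrrUnitaryRep G)
    (j : E →ₗᵢ[ℂ] (H →L[ℂ] H)) : MatrixNorms (dualLinfty rep j) :=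
  fun n A => ⨆ π : DualObject G, opMatrixNorm j
    (Matrix.comp (Fin n) (Fin n) (Fin (rep π).deg) (Fin (rep π).deg) E
      (Matrix.of fun i j => (A i j).1 π))

/-- The completely bounded norm of a linear map `L^1_E(G) → 𝓛^∞_E(Ĝ)`. -/
def fourierCbNorm {rep : DualObject G → IrrUnitaryRep G} {j : E →ₗᵢ[ℂ] (H →L[ℂ] H)}
    (Λ : Lp E 1 μ →ₗ[ℂ] dualLinfty rep j) : ℝ≥0∞ :=
  cbNorm (bochnerMatrixNorms μ j) (dualLinftyMatrixNorms rep j) Λ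

/-- `Λ : L^1_E(G) → 𝓛^∞_E(Ĝ)` is a completely bounded extension of the Fourier transform on
`L^1(G) ⊗ E`, which maps `f ⊗ e` to `f̂ ⊗ e`. The operator space `E` has Fourier type `1` with
respect to `G` if there is such a `Λ`, and then `C_1^1(E, G)` is `fourierCbNorm μ Λ`. -/
def IsCbFourierExtension {rep : DualObject G → IrrUnitaryRep G} {j : E →ₗᵢ[ℂ] (H →L[ℂ] H)}
    (Λ : Lp E 1 μ →ₗ[ℂ] dualLinfty rep j) : Prop :=
  (∀ (f : Lp ℂ 1 μ) (e : E) (π : DualObject G),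
    (Λ (tensorToLp μ (f ⊗ₜ[ℂ] e))).1 π = (fourierCoeff μ (rep π) f).map fun c => c • e) ∧
  fourierCbNorm μ Λ < ∞

end Fourier

end FourierType

end

noncomputable section

namespace FourierType

/-! ### Operator norms of scalar matrices -/

section ScalarNorm

variable {m n : Type*} [Fintype m] [Fintype n] [DecidableEq n]

/-! The upper bound rests on unitarity alone: `g ↦ π(g)^*` lies in the unit ball of `M_d(L^∞)`, `d =
d_π`. A matrix `v ∈ M_p(L^1)` is a map `L^∞ → M_p`, and evaluating its amplification at `π^*` gives
the Fourier coefficient, so the coefficient has norm at most `‖v‖` in `M_{dp}`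
(`scalarNorm_fourierCoeff_le`). If `u = α (v ⊗ w) β`, the coefficient of `u` is `α (v̂(π) ⊗ w) β` up
to reordering indices. The four factors act on separate tensor legs of a Hilbert space, so its norm
is at most `‖α‖ ‖v‖ ‖w‖ ‖β‖` (`opMatrixNorm_factorization_le`). Taking the infimum and passing to
limits by continuity gives `‖Λ‖_cb ≤ 1`.

For uniqueness and the lower bound it is enough to compare norms on `1 × 1` matrices: the norm of
`L^1_E` there is at most the Bochner norm (`bochnerMatrixNorms_one_le`), because a simple function
is a disjoint sum of tensors whose projective cost is its `L^1` norm. Hence a completely bounded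
extension has continuous entries and is determined on the dense image of `L^1 ⊗ E`. Finally, a
constant function of norm one has itself as coefficient at the trivial representation, so the
constant is at least 1. -/

theorem sum_norm_sq_le_scalarNorm (a : Matrix m n ℂ) (x : n → ℂ) :
    ∑ i, ‖∑ k, a i k * x k‖ ^ 2 ≤ (scalarNorm a).toReal ^ 2 * ∑ k, ‖x k‖ ^ 2 := by
  have h := ContinuousLinearMap.le_opNorm
    (LinearMap.toContinuousLinearMap (Matrix.toEuclideanLin a)) (WithLp.toLp 2 x)
  have h2 := pow_le_pow_left₀ (norm_nonneg _) h 2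
  rw [mul_pow, EuclideanSpace.norm_sq_eq, EuclideanSpace.norm_sq_eq] at h2
  simpa [scalarNorm, Matrix.toLpLin_apply, Matrix.mulVec, dotProduct] using h2

theorem scalarNorm_le (a : Matrix m n ℂ) {c : ℝ} (hc : 0 ≤ c)
    (h : ∀ x : n → ℂ, ∑ i, ‖∑ k, a i k * x k‖ ^ 2 ≤ c ^ 2 * ∑ k, ‖x k‖ ^ 2) :
    scalarNorm a ≤ ENNReal.ofReal c := by
  rw [scalarNorm, ← ofReal_norm]
  refine ENNReal.ofReal_le_ofReal (ContinuousLinearMap.opNorm_le_bound _ hc fun x => ?_)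
  refine le_of_sq_le_sq ?_ (by positivity)
  rw [mul_pow, EuclideanSpace.norm_sq_eq, EuclideanSpace.norm_sq_eq]
  simpa [Matrix.toLpLin_apply, Matrix.mulVec, dotProduct] using h x

theorem scalarNorm_ne_top (a : Matrix m n ℂ) : scalarNorm a ≠ ∞ := enorm_ne_top

/-- The operator norm is at most the Hilbert–Schmidt norm. -/
theorem scalarNorm_le_sqrt (a : Matrix m n ℂ) :
    scalarNorm a ≤ ENNReal.ofReal (√(∑ i, ∑ k, ‖a i k‖ ^ 2)) := by
  refine scalarNorm_le a (Real.sqrt_nonneg _) fun x => ?_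
  rw [Real.sq_sqrt (by positivity), Finset.sum_mul]
  refine Finset.sum_le_sum fun i _ => ?_
  calc ‖∑ k, a i k * x k‖ ^ 2 ≤ (∑ k, ‖a i k‖ * ‖x k‖) ^ 2 := by
        gcongr
        exact (norm_sum_le _ _).trans (by simp)
    _ ≤ _ := Finset.sum_mul_sq_le_sq_mul_sq _ _ _

/-- A scalar matrix acts on `ℓ²_H` with the same bound as on `ℓ²`. -/
theorem sum_norm_sq_smul_le_scalarNorm {H : Type*} [NormedAddCommGroup H] [InnerProductSpace ℂ H]
    (a : Matrix m n ℂ) (x : n → H) :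
    ∑ i, ‖∑ k, a i k • x k‖ ^ 2 ≤ (scalarNorm a).toReal ^ 2 * ∑ k, ‖x k‖ ^ 2 := by
  -- The vectors `x k` span a finite-dimensional space; in an orthonormal basis of it the claim
  -- splits into one scalar inequality per coordinate.
  let S : Submodule ℂ H := Submodule.span ℂ (Set.range x)
  have : FiniteDimensional ℂ S := FiniteDimensional.span_of_finite ℂ (Set.finite_range x)
  let y : n → S := fun k => ⟨x k, Submodule.subset_span ⟨k, rfl⟩⟩
  let b := stdOrthonormalBasis ℂ S
  have key : ∀ z : S, ‖z‖ ^ 2 = ∑ t, ‖b.repr z t‖ ^ 2 := fun z => by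
    rw [← b.repr.norm_map z, EuclideanSpace.norm_sq_eq]
  have h1 : ∀ i, ‖∑ k, a i k • x k‖ ^ 2 = ∑ t, ‖∑ k, a i k * b.repr (y k) t‖ ^ 2 := fun i => by
    have e : ((∑ k, a i k • y k : S) : H) = ∑ k, a i k • x k := by simp [y]
    rw [← e, Submodule.norm_coe, key]
    simp
  have h2 : ∀ k, ‖x k‖ ^ 2 = ∑ t, ‖b.repr (y k) t‖ ^ 2 := fun k => by
    rw [← key]; rfl
  simp_rw [h1, h2]
  rw [Finset.sum_comm, Finset.sum_comm (s := Finset.univ (α := n)), Finset.mul_sum]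
  exact Finset.sum_le_sum fun t _ => sum_norm_sq_le_scalarNorm a _

end ScalarNorm

/-! ### Norms of matrices of operators -/

section BlockNorm

variable {F : Type*} [NormedAddCommGroup F] [NormedSpace ℂ F] {ι : Type*} [Fintype ι]

theorem sum_norm_sq_le_blockNorm (a : Matrix ι ι (F →L[ℂ] F)) (x : ι → F) :
    ∑ i, ‖∑ k, a i k (x k)‖ ^ 2 ≤ (blockNorm a).toReal ^ 2 * ∑ k, ‖x k‖ ^ 2 := by
  have h := ContinuousLinearMap.le_opNorm (blockOp a) (WithLp.toLp 2 x)
  have h2 := pow_le_pow_left₀ (norm_nonneg _) h 2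
  rw [mul_pow, PiLp.norm_sq_eq_of_L2, PiLp.norm_sq_eq_of_L2] at h2
  simpa [blockNorm, blockOp_apply] using h2

theorem blockNorm_le (a : Matrix ι ι (F →L[ℂ] F)) {c : ℝ} (hc : 0 ≤ c)
    (h : ∀ x : ι → F, ∑ i, ‖∑ k, a i k (x k)‖ ^ 2 ≤ c ^ 2 * ∑ k, ‖x k‖ ^ 2) :
    blockNorm a ≤ ENNReal.ofReal c := by
  rw [blockNorm, ← ofReal_norm]
  refine ENNReal.ofReal_le_ofReal (ContinuousLinearMap.opNorm_le_bound _ hc fun x => ?_)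
  refine le_of_sq_le_sq ?_ (by positivity)
  rw [mul_pow, PiLp.norm_sq_eq_of_L2, PiLp.norm_sq_eq_of_L2]
  simpa [blockOp_apply] using h x

theorem blockNorm_ne_top (a : Matrix ι ι (F →L[ℂ] F)) : blockNorm a ≠ ∞ := enorm_ne_top

theorem enorm_apply_le_blockNorm [DecidableEq ι] (a : Matrix ι ι (F →L[ℂ] F)) (i k : ι) :
    ‖a i k‖ₑ ≤ blockNorm a := by
  rw [← ENNReal.ofReal_toReal (blockNorm_ne_top a), ← ofReal_norm]
  refine ENNReal.ofReal_le_ofReal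
    (ContinuousLinearMap.opNorm_le_bound _ ENNReal.toReal_nonneg fun x => ?_)
  refine le_of_sq_le_sq ?_ (by positivity)
  have h := sum_norm_sq_le_blockNorm a (Pi.single k x)
  have h1 : ∀ i, ∑ l, a i l (Pi.single (M := fun _ => F) k x l) = a i k x := fun i => by
    rw [Finset.sum_eq_single k] <;> simp +contextual
  have h2 : ∑ l, ‖Pi.single (M := fun _ => F) k x l‖ ^ 2 = ‖x‖ ^ 2 := by
    rw [Finset.sum_eq_single k] <;> simp +contextual
  simp_rw [h1] at h
  rw [h2, ← mul_pow] at h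
  exact (Finset.single_le_sum (f := fun i => ‖a i k x‖ ^ 2) (fun _ _ => by positivity)
    (Finset.mem_univ i)).trans h

theorem blockNorm_submatrix_le {κ : Type*} [Fintype κ] (a : Matrix ι ι (F →L[ℂ] F)) (e : κ ≃ ι) :
    blockNorm (a.submatrix e e) ≤ blockNorm a := by
  rw [← ENNReal.ofReal_toReal (blockNorm_ne_top a)]
  refine blockNorm_le _ ENNReal.toReal_nonneg fun x => ?_
  have h := sum_norm_sq_le_blockNorm a (x ∘ e.symm)
  rw [← e.sum_comp, ← e.sum_comp (fun k => ‖(x ∘ e.symm) k‖ ^ 2)] at h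
  simp_rw [← e.sum_comp (fun k => a _ k ((x ∘ e.symm) k))] at h
  simpa using h

theorem blockNorm_diagonal_le [DecidableEq ι] (w : ι → F →L[ℂ] F) (hw : ∀ i, ‖w i‖ ≤ 1) :
    blockNorm (Matrix.diagonal w) ≤ 1 := by
  rw [← ENNReal.ofReal_one]
  refine blockNorm_le _ zero_le_one fun x => ?_
  rw [one_pow, one_mul]
  refine Finset.sum_le_sum fun i _ => ?_
  rw [Finset.sum_eq_single i]
  · rw [Matrix.diagonal_apply_eq]
    gcongr
    exact (w i).le_of_opNorm_le (hw i) _ |>.trans (by simp)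
  · intro k _ hk
    simp [Matrix.diagonal_apply_ne' _ hk]
  · simp

/-- `blockOp` is a finite sum of compositions, each depending continuously on one entry. This
continuity later carries the estimate from `L^1 ⊗ E` to its completion. -/
theorem continuous_blockNorm :
    Continuous (blockNorm : Matrix ι ι (F →L[ℂ] F) → ℝ≥0∞) := by
  classical
  have h : (blockOp : Matrix ι ι (F →L[ℂ] F) → _) = fun a => ∑ i, ∑ k,
      ((PiLp.continuousLinearEquiv 2 ℂ (fun _ : ι => F)).symm.toContinuousLinearMap ∘L
        ContinuousLinearMap.single ℂ (fun _ : ι => F) i) ∘L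
        (a i k ∘L ((ContinuousLinearMap.proj k) ∘L
          (PiLp.continuousLinearEquiv 2 ℂ (fun _ : ι => F)).toContinuousLinearMap)) := by
    funext a
    ext x l
    rw [blockOp_apply]
    simp [Pi.single_apply]
  have hc : Continuous (blockOp : Matrix ι ι (F →L[ℂ] F) → _) := by
    rw [h]
    refine continuous_finsetSum _ fun i _ => continuous_finsetSum _ fun k _ => ?_
    exact continuous_const.clm_comp
      ((continuous_id.matrix_elem i k).clm_comp continuous_const)
  exact hc.enorm

end BlockNorm

/-! ### Matrices over the operator space and the factorization estimate -/

section OpMatrixNorm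

variable {H : Type*} [NormedAddCommGroup H] [InnerProductSpace ℂ H]
  {E : Type*} [NormedAddCommGroup E] [NormedSpace ℂ E] (j : E →ₗᵢ[ℂ] (H →L[ℂ] H))
  {ι : Type*} [Fintype ι]

theorem enorm_apply_le_opMatrixNorm [DecidableEq ι] (a : Matrix ι ι E) (i k : ι) :
    ‖a i k‖ₑ ≤ opMatrixNorm j a := by
  have h := enorm_apply_le_blockNorm (a.map j) i k
  rwa [Matrix.map_apply, ← ofReal_norm, j.norm_map, ofReal_norm] at h

theorem opMatrixNorm_ne_top (a : Matrix ι ι E) : opMatrixNorm j a ≠ ∞ := blockNorm_ne_top _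

theorem continuous_opMatrixNorm : Continuous (opMatrixNorm j : Matrix ι ι E → ℝ≥0∞) :=
  continuous_blockNorm.comp (continuous_id.matrix_map j.continuous)

theorem opMatrixNorm_submatrix_le {κ : Type*} [Fintype κ] (a : Matrix ι ι E) (e : κ ≃ ι) :
    opMatrixNorm j (a.submatrix e e) ≤ opMatrixNorm j a :=
  blockNorm_submatrix_le (a.map j) e

theorem opMatrixNorm_diagonal_le [DecidableEq ι] (w : ι → E) (hw : ∀ i, ‖w i‖ ≤ 1) :
    opMatrixNorm j (Matrix.diagonal w) ≤ 1 := by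
  rw [opMatrixNorm, Matrix.diagonal_map (map_zero j)]
  exact blockNorm_diagonal_le _ fun i => (j.norm_map _).trans_le (hw i)

/-- Identifies `M_ι(E)` with `M_1(M_ι(E))`, so that cb estimates can be read at `n = 1`. -/
theorem opMatrixNorm_le_comp_of_unique {κ : Type*} [Fintype κ] [Unique κ] (a : Matrix ι ι E) :
    opMatrixNorm j a ≤ opMatrixNorm j (Matrix.comp κ κ ι ι E (Matrix.of fun _ _ => a)) :=
  opMatrixNorm_submatrix_le j (Matrix.comp κ κ ι ι E (Matrix.of fun _ _ => a))
    (Equiv.uniqueProd ι κ).symm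

/-- The estimate `‖α (V ⊗ w) β‖ ≤ ‖α‖ ‖V‖ ‖w‖ ‖β‖` with `V` over a matrix algebra. -/
theorem opMatrixNorm_factorization_le {d n p q : Type*} [Fintype d] [Fintype n] [Fintype p]
    [Fintype q] [DecidableEq d] [DecidableEq n] [DecidableEq p] [DecidableEq q]
    (α : Matrix n (p × q) ℂ) (V : Matrix (d × p) (d × p) ℂ) (w : Matrix q q E)
    (β : Matrix (p × q) n ℂ) :
    opMatrixNorm j (Matrix.of fun x y : n × d => ∑ r : p × q, ∑ s : p × q,
      (α x.1 r * β s y.1) • V (x.2, r.1) (y.2, s.1) • w r.2 s.2) ≤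
      scalarNorm α * scalarNorm V * opMatrixNorm j w * scalarNorm β := by
  set A := (scalarNorm α).toReal with hA
  set B := (scalarNorm β).toReal with hB
  set C := (scalarNorm V).toReal with hC
  set D := (opMatrixNorm j w).toReal with hD
  have hRHS : scalarNorm α * scalarNorm V * opMatrixNorm j w * scalarNorm β =
      ENNReal.ofReal (A * C * D * B) := by
    rw [ENNReal.ofReal_mul (by positivity), ENNReal.ofReal_mul (by positivity),
      ENNReal.ofReal_mul (by positivity), hA, hB, hC, hD,
      ENNReal.ofReal_toReal (scalarNorm_ne_top _), ENNReal.ofReal_toReal (scalarNorm_ne_top _),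
      ENNReal.ofReal_toReal (scalarNorm_ne_top _), ENNReal.ofReal_toReal (opMatrixNorm_ne_top _ _)]
  rw [hRHS]
  refine blockNorm_le _ (by positivity) fun h => ?_
  -- The operator is applied to `h` one factor at a time: `x1` after `β`, `x2` after `w`, `x3` after
  -- `V`, and `α` last. Each factor moves only its own indices and leaves the others as parameters.
  let x1 : p × q → d → H := fun s b => ∑ k, β s k • h (k, b)
  let x2 : p → q → d → H := fun s r b => ∑ t, j (w r t) (x1 (s, t) b)
  let x3 : p × q → d → H := fun r a => ∑ y : d × p, V (a, r.1) y • x2 y.2 r.2 y.1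
  have e4 : ∀ x : n × d, ∑ y : n × d, ((Matrix.of fun x y : n × d => ∑ r : p × q, ∑ s : p × q,
      (α x.1 r * β s y.1) • V (x.2, r.1) (y.2, s.1) • w r.2 s.2).map j) x y (h y) =
      ∑ r, α x.1 r • x3 r x.2 := by
    rintro ⟨i, a⟩
    simp only [x3, x2, x1, Matrix.map_apply, Matrix.of_apply, map_sum, map_smul,
      sum_apply, smul_apply, Finset.smul_sum]
    rw [Finset.sum_comm]
    refine Finset.sum_congr rfl fun r _ => ?_
    simp only [Fintype.sum_prod_type]
    rw [Finset.sum_comm]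
    refine Finset.sum_congr rfl fun b _ => ?_
    rw [Finset.sum_comm]
    refine Finset.sum_congr rfl fun s _ => ?_
    rw [Finset.sum_comm]
    refine Finset.sum_congr rfl fun t _ => Finset.sum_congr rfl fun k _ => ?_
    simp only [smul_smul]
    ring_nf
  have h4 : ∑ x : n × d, ‖∑ r, α x.1 r • x3 r x.2‖ ^ 2 ≤ A ^ 2 * ∑ a, ∑ r, ‖x3 r a‖ ^ 2 := by
    rw [Fintype.sum_prod_type_right, Finset.mul_sum]
    exact Finset.sum_le_sum fun a _ => sum_norm_sq_smul_le_scalarNorm α fun r => x3 r a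
  have h3 : ∑ a, ∑ r, ‖x3 r a‖ ^ 2 ≤ C ^ 2 * ∑ r : q, ∑ y : d × p, ‖x2 y.2 r y.1‖ ^ 2 := by
    -- Regrouped with the `q`-index outermost, since `V` acts on `d × p` for each fixed `q`-index.
    have : ∑ a, ∑ r, ‖x3 r a‖ ^ 2 = ∑ r2 : q, ∑ y : d × p, ‖x3 (y.2, r2) y.1‖ ^ 2 := by
      simp_rw [Fintype.sum_prod_type]
      rw [Finset.sum_comm' (s := Finset.univ (α := q)) (t' := Finset.univ)
        (s' := fun _ => Finset.univ) (by simp)]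
      exact Finset.sum_congr rfl fun a _ => Finset.sum_comm
    rw [this, Finset.mul_sum]
    exact Finset.sum_le_sum fun r _ =>
      sum_norm_sq_smul_le_scalarNorm V fun y : d × p => x2 y.2 r y.1
  have h2 : ∑ r : q, ∑ y : d × p, ‖x2 y.2 r y.1‖ ^ 2 ≤
      D ^ 2 * ∑ y : d × p, ∑ t, ‖x1 (y.2, t) y.1‖ ^ 2 := by
    rw [Finset.sum_comm, Finset.mul_sum]
    exact Finset.sum_le_sum fun y _ =>
      sum_norm_sq_le_blockNorm (w.map j) fun t => x1 (y.2, t) y.1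
  have h1 : ∑ y : d × p, ∑ t, ‖x1 (y.2, t) y.1‖ ^ 2 ≤ B ^ 2 * ∑ k, ‖h k‖ ^ 2 := by
    have : ∑ y : d × p, ∑ t, ‖x1 (y.2, t) y.1‖ ^ 2 = ∑ b, ∑ s, ‖x1 s b‖ ^ 2 := by
      simp_rw [Fintype.sum_prod_type]
    rw [this, Fintype.sum_prod_type_right (fun k : n × d => ‖h k‖ ^ 2), Finset.mul_sum]
    exact Finset.sum_le_sum fun b _ => sum_norm_sq_smul_le_scalarNorm β fun k => h (k, b)
  simp_rw [e4]
  calc _ ≤ _ := h4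
    _ ≤ A ^ 2 * (C ^ 2 * (D ^ 2 * (B ^ 2 * ∑ k, ‖h k‖ ^ 2))) := by
        gcongr
        refine h3.trans ?_
        gcongr
        refine h2.trans ?_
        gcongr
    _ = _ := by ring

end OpMatrixNorm

/-! ### Fourier coefficients and the upper bound -/

section Fourier

variable {G : Type*} [Group G] [TopologicalSpace G]

theorem IrrUnitaryRep.scalarNorm_conjTranspose_mat_le (π : IrrUnitaryRep G) (g : G) :
    scalarNorm (π.mat g).conjTranspose ≤ 1 := by
  rw [← ENNReal.ofReal_one]
  refine scalarNorm_le _ zero_le_one fun x => ?_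
  have h : π.mat g * (π.mat g).conjTranspose = 1 := (π.hom g).2.2
  have key : star (Matrix.mulVec (π.mat g).conjTranspose x) ⬝ᵥ
      Matrix.mulVec (π.mat g).conjTranspose x = star x ⬝ᵥ x := by
    rw [Matrix.star_mulVec, Matrix.conjTranspose_conjTranspose, ← Matrix.dotProduct_mulVec,
      Matrix.mulVec_mulVec, h, Matrix.one_mulVec]
  have e : ∀ y : Fin π.deg → ℂ, star y ⬝ᵥ y = ((∑ i, ‖y i‖ ^ 2 : ℝ) : ℂ) := fun y => by
    simp [dotProduct, Complex.conj_mul']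
  rw [e, e] at key
  have key' := Complex.ofReal_injective key
  simp only [Matrix.mulVec, dotProduct] at key'
  rw [key', one_pow, one_mul]

theorem IrrUnitaryRep.norm_conjTranspose_mat_le (π : IrrUnitaryRep G) (g : G)
    (i k : Fin π.deg) : ‖(π.mat g).conjTranspose i k‖ ≤ 1 := by
  simpa using entry_norm_bound_of_unitary (U := π.mat g) (π.hom g).2 k i

theorem IrrUnitaryRep.continuous_conjTranspose_mat (π : IrrUnitaryRep G) (i k : Fin π.deg) :
    Continuous fun g => (π.mat g).conjTranspose i k :=
  π.continuous_hom.matrix_conjTranspose.matrix_elem i k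

variable [MeasurableSpace G] (μ : Measure G)

section

variable {V : Type*} [NormedAddCommGroup V] [NormedSpace ℂ V]

theorem norm_fourierCoeff_apply_le (π : IrrUnitaryRep G) (f : Lp V 1 μ) (i k : Fin π.deg) :
    ‖fourierCoeff μ π f i k‖ ≤ ‖f‖ := by
  rw [L1.norm_eq_integral_norm]
  refine norm_integral_le_of_norm_le (L1.integrable_coeFn f).norm (ae_of_all _ fun g => ?_)
  rw [norm_smul]
  exact mul_le_of_le_one_left (norm_nonneg _) (π.norm_conjTranspose_mat_le g i k)

theorem fourierCoeff_tensorToLp [CompleteSpace V] (π : IrrUnitaryRep G) (f : Lp ℂ 1 μ) (v : V) :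
    fourierCoeff μ π (tensorToLp μ (f ⊗ₜ[ℂ] v)) = (fourierCoeff μ π f).map fun c => c • v := by
  ext i k
  simp only [fourierCoeff, Matrix.of_apply, Matrix.map_apply]
  rw [← integral_smul_const]
  apply integral_congr_ae
  filter_upwards [tensorToLp_tmul μ f v] with x hx
  rw [hx, smul_smul, smul_eq_mul]

end

variable [BorelSpace G]

theorem IrrUnitaryRep.memLp_conjTranspose_mat (π : IrrUnitaryRep G) (i k : Fin π.deg) :
    MemLp (fun g => (π.mat g).conjTranspose i k) ∞ μ :=
  memLp_top_of_bound (π.continuous_conjTranspose_mat i k).aestronglyMeasurable 1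
    (ae_of_all _ fun g => π.norm_conjTranspose_mat_le g i k)

section

variable {V : Type*} [NormedAddCommGroup V] [NormedSpace ℂ V]

theorem integrable_conjTranspose_mat_smul (π : IrrUnitaryRep G) (f : Lp V 1 μ)
    (i k : Fin π.deg) : Integrable (fun g => (π.mat g).conjTranspose i k • f g) μ :=
  (L1.integrable_coeFn f).bdd_smul 1
    (π.continuous_conjTranspose_mat i k).aestronglyMeasurable
    (ae_of_all _ fun g => π.norm_conjTranspose_mat_le g i k)

/-- The Fourier coefficient as a linear map. -/
def fourierCoeffₗ (π : IrrUnitaryRep G) :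
    Lp V 1 μ →ₗ[ℂ] Matrix (Fin π.deg) (Fin π.deg) V where
  toFun := fourierCoeff μ π
  map_add' f h := by
    ext i k
    simp only [fourierCoeff, Matrix.of_apply, Matrix.add_apply]
    rw [← integral_add (integrable_conjTranspose_mat_smul μ π f i k)
      (integrable_conjTranspose_mat_smul μ π h i k)]
    apply integral_congr_ae
    filter_upwards [Lp.coeFn_add f h] with x hx
    rw [hx, Pi.add_apply, smul_add]
  map_smul' c f := by
    ext i k
    simp only [fourierCoeff, Matrix.of_apply, Matrix.smul_apply, RingHom.id_apply]
    rw [← integral_smul]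
    apply integral_congr_ae
    filter_upwards [Lp.coeFn_smul c f] with x hx
    rw [hx, Pi.smul_apply, smul_comm]

theorem continuous_fourierCoeff (π : IrrUnitaryRep G) :
    Continuous (fourierCoeff μ π : Lp V 1 μ → _) := by
  refine continuous_matrix fun i k => ?_
  let T : Lp V 1 μ →ₗ[ℂ] V := Matrix.entryLinearMap ℂ V i k ∘ₗ fourierCoeffₗ μ π
  exact (T.mkContinuous 1 fun f =>
    (norm_fourierCoeff_apply_le μ π f i k).trans_eq (one_mul _).symm).continuous

end

/-- The matrix `π^*` is an admissible test element of `M_d(L^∞)` in the supremum defining the norm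
of `v`, because each `π(g)^*` is a contraction; pairing `v` with it yields exactly the Fourier
coefficients. -/
theorem scalarNorm_fourierCoeff_le (π : IrrUnitaryRep G) {p : ℕ}
    (v : Matrix (Fin p) (Fin p) (Lp ℂ 1 μ)) :
    scalarNorm (Matrix.of fun x y : Fin π.deg × Fin p =>
      fourierCoeff μ π (v x.2 y.2) x.1 y.1) ≤ loneMatrixNorms μ p v := by
  let X : Matrix (Fin π.deg) (Fin π.deg) (Lp ℂ ∞ μ) := Matrix.of fun i k =>
    (π.memLp_conjTranspose_mat μ i k).toLp
  have hX : ∀ᵐ g ∂μ, ∀ i k, X i k g = (π.mat g).conjTranspose i k := by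
    rw [ae_all_iff]; intro i
    rw [ae_all_iff]; intro k
    exact (π.memLp_conjTranspose_mat μ i k).coeFn_toLp
  have hX1 : linftyMatrixNorms μ π.deg X ≤ 1 := by
    refine essSup_le_of_ae_le _ ?_
    filter_upwards [hX] with g hg
    simp_rw [hg]
    exact π.scalarNorm_conjTranspose_mat_le g
  have h := le_iSup_of_le π.deg (le_iSup₂_of_le X hX1 le_rfl) (a :=
    scalarMatrixNorms p π.deg (X.map (pairing μ v))) (f := fun n =>
      ⨆ (x : Matrix (Fin n) (Fin n) (Lp ℂ ∞ μ)) (_ : linftyMatrixNorms μ n x ≤ 1),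
        scalarMatrixNorms p n (x.map (pairing μ v)))
  refine le_of_eq_of_le ?_ h
  unfold scalarMatrixNorms
  congr 1
  ext ⟨i, r⟩ ⟨k, s⟩
  simp only [fourierCoeff, Matrix.of_apply, Matrix.comp_apply, Matrix.map_apply, pairing,
    LinearMap.coe_mk, AddHom.coe_mk]
  apply integral_congr_ae
  filter_upwards [hX] with g hg
  rw [hg, smul_eq_mul, mul_comm]

variable {H : Type*} [NormedAddCommGroup H] [InnerProductSpace ℂ H]
  {E : Type*} [NormedAddCommGroup E] [NormedSpace ℂ E] [CompleteSpace E]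
  (j : E →ₗᵢ[ℂ] (H →L[ℂ] H))

theorem opMatrixNorm_fourierCoeff_le_projMatrixNorms (π : IrrUnitaryRep G) {n : ℕ}
    (u : Matrix (Fin n) (Fin n) (Lp ℂ 1 μ ⊗[ℂ] E)) :
    opMatrixNorm j (Matrix.comp _ _ _ _ E
      (Matrix.of fun i k => fourierCoeff μ π (tensorToLp μ (u i k)))) ≤
      projMatrixNorms (loneMatrixNorms μ) (spaceMatrixNorms j) n u := by
  refine le_iInf fun p => le_iInf fun q => le_iInf fun α => le_iInf fun v => le_iInf fun w =>
    le_iInf fun β => le_iInf fun h => ?_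
  have hu : Matrix.comp _ _ _ _ E
      (Matrix.of fun i k => fourierCoeff μ π (tensorToLp μ (u i k))) =
      Matrix.of fun x y : Fin n × Fin π.deg => ∑ r : Fin p × Fin q, ∑ s : Fin p × Fin q,
        (α x.1 r * β s y.1) • (Matrix.of fun x y : Fin π.deg × Fin p =>
          fourierCoeff μ π (v x.2 y.2) x.1 y.1) (x.2, r.1) (y.2, s.1) • w r.2 s.2 := by
    ext ⟨i, a⟩ ⟨k, b⟩
    simp only [Matrix.comp_apply, Matrix.of_apply, h]
    change (fourierCoeffₗ μ π (tensorToLp μ _)) a b = _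
    simp only [map_sum, map_smul, Matrix.sum_apply, Matrix.smul_apply]
    refine Finset.sum_congr rfl fun r _ => Finset.sum_congr rfl fun s _ => ?_
    change _ • fourierCoeff μ π _ a b = _
    rw [fourierCoeff_tensorToLp]
    rfl
  rw [hu]
  refine (opMatrixNorm_factorization_le j α _ w β).trans ?_
  gcongr
  · exact scalarNorm_fourierCoeff_le μ π v
  · exact le_rfl

/-- The left side is continuous in `F`, so along matrices over `L^1 ⊗ E` converging to `F` it tends
to its value at `F`, while staying below their projective norms. -/
theorem opMatrixNorm_fourierCoeff_le_bochnerMatrixNorms (π : IrrUnitaryRep G) {n : ℕ}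
    (F : Matrix (Fin n) (Fin n) (Lp E 1 μ)) :
    opMatrixNorm j (Matrix.comp _ _ _ _ E (Matrix.of fun i k => fourierCoeff μ π (F i k))) ≤
      bochnerMatrixNorms μ j n F := by
  let T : Matrix (Fin n) (Fin n) (Lp E 1 μ) → ℝ≥0∞ := fun F =>
    opMatrixNorm j (Matrix.comp _ _ _ _ E (Matrix.of fun i k => fourierCoeff μ π (F i k)))
  have hT : Continuous T := by
    refine (continuous_opMatrixNorm j).comp (continuous_matrix fun x y => ?_)
    exact ((continuous_fourierCoeff μ π).matrix_elem x.2 y.2).comp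
      (continuous_id.matrix_elem x.1 y.1)
  have ht := (hT.tendsto F).comp (tendsto_comap
    (f := fun u : Matrix (Fin n) (Fin n) (Lp ℂ 1 μ ⊗[ℂ] E) => u.map (tensorToLp μ)) (x := 𝓝 F))
  rw [bochnerMatrixNorms]
  rcases (comap (fun u : Matrix (Fin n) (Fin n) (Lp ℂ 1 μ ⊗[ℂ] E) => u.map (tensorToLp μ))
    (𝓝 F)).eq_or_neBot with hb | hb
  -- Along the trivial filter the liminf is `∞`, so no density is needed for this inequality.
  · rw [hb]; simp [liminf_bot]
  · change T F ≤ _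
    rw [← ht.liminf_eq]
    exact liminf_le_liminf (.of_forall fun u =>
      opMatrixNorm_fourierCoeff_le_projMatrixNorms μ j π u)

end Fourier

/-! ### Comparison of the `1 × 1` norm of `L^1_E` with the Bochner norm -/

section Lebesgue

variable {Ω : Type*} [MeasurableSpace Ω] (μ : Measure Ω)

/-- A contractive functional `∫ f ·` is completely contractive: the matrix is an operator-valued
integral, bounded by `∫ |f| ‖x(ω)‖`. -/
theorem scalarNorm_integral_mul_le (f : Lp ℂ 1 μ) (hf : ‖f‖ ≤ 1) {m : ℕ}
    (x : Matrix (Fin m) (Fin m) (Lp ℂ ∞ μ)) (hx : linftyMatrixNorms μ m x ≤ 1) :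
    scalarNorm (Matrix.of fun k l => ∫ ω, f ω * x k l ω ∂μ) ≤ 1 := by
  let T : Matrix (Fin m) (Fin m) ℂ →ₗ[ℂ] EuclideanSpace ℂ (Fin m) →L[ℂ] EuclideanSpace ℂ (Fin m) :=
    LinearMap.toContinuousLinearMap.toLinearMap ∘ₗ Matrix.toEuclideanLin.toLinearMap
  -- Expansion in matrix units reduces interchanging `T` with the integral to finitely many scalar
  -- integrals.
  have hT : ∀ a : Matrix (Fin m) (Fin m) ℂ,
      T a = ∑ k, ∑ l, a k l • T (Matrix.single k l 1) := fun a => by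
    conv_lhs => rw [Matrix.matrix_eq_sum_single a]
    simp only [map_sum, ← map_smul, Matrix.smul_single, smul_eq_mul, mul_one]
  have hi : ∀ k l, Integrable (fun ω => f ω * x k l ω) μ := fun k l =>
    integrable_mul_linfty μ f (x k l)
  have key : T (Matrix.of fun k l => ∫ ω, f ω * x k l ω ∂μ) =
      ∫ ω, T (Matrix.of fun k l => f ω * x k l ω) ∂μ := by
    simp_rw [hT (Matrix.of _), Matrix.of_apply]
    rw [integral_finsetSum _ fun k _ => integrable_finsetSum _ fun l _ => (hi k l).smul_const _]
    refine Finset.sum_congr rfl fun k _ => ?_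
    rw [integral_finsetSum _ fun l _ => (hi k l).smul_const _]
    exact Finset.sum_congr rfl fun l _ => (integral_smul_const
      (fun ω => f ω * x k l ω) (T (Matrix.single k l 1))).symm
  have hx1 : ∀ᵐ ω ∂μ, ‖T (Matrix.of fun k l => x k l ω)‖ ≤ 1 := by
    filter_upwards [ENNReal.ae_le_essSup
      (fun ω => scalarNorm (Matrix.of fun k l : Fin m => x k l ω)) (μ := μ)] with ω hω
    have h1 : ‖T (Matrix.of fun k l => x k l ω)‖ₑ ≤ 1 := hω.trans hx
    rwa [← ofReal_norm, ENNReal.ofReal_le_one] at h1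
  have h1 : ‖T (Matrix.of fun k l => ∫ ω, f ω * x k l ω ∂μ)‖ ≤ 1 := by
    rw [key]
    refine (norm_integral_le_of_norm_le (L1.integrable_coeFn f).norm ?_).trans
      ((L1.norm_eq_integral_norm f).symm.trans_le hf)
    filter_upwards [hx1] with ω hω
    have : (Matrix.of fun k l => f ω * x k l ω) = f ω • Matrix.of fun k l => x k l ω := by
      ext; simp
    rw [this, map_smul, norm_smul]
    exact mul_le_of_le_one_right (norm_nonneg _) hω
  change ‖T (Matrix.of fun k l => ∫ ω, f ω * x k l ω ∂μ)‖ₑ ≤ 1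
  rwa [← ofReal_norm, ENNReal.ofReal_le_one]

/-- The amplified pairing is block diagonal, with one contractive block for each `v i`. -/
theorem loneMatrixNorms_diagonal_le {p : ℕ} (v : Fin p → Lp ℂ 1 μ) (hv : ∀ i, ‖v i‖ ≤ 1) :
    loneMatrixNorms μ p (Matrix.diagonal v) ≤ 1 := by
  refine iSup_le fun m => iSup₂_le fun x hx => ?_
  refine (scalarNorm_le _ zero_le_one fun h => ?_).trans_eq ENNReal.ofReal_one
  rw [one_pow, one_mul, Fintype.sum_prod_type_right, Fintype.sum_prod_type_right]
  refine Finset.sum_le_sum fun i _ => ?_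
  have e : ∀ a : Fin m, ∑ k : Fin m × Fin p, (Matrix.comp (Fin m) (Fin m) (Fin p) (Fin p) ℂ
      (x.map (pairing μ (Matrix.diagonal v)))) (a, i) k * h k =
      ∑ b, (Matrix.of fun k l => ∫ ω, v i ω * x k l ω ∂μ) a b * h (b, i) := fun a => by
    rw [Fintype.sum_prod_type]
    refine Finset.sum_congr rfl fun b _ => ?_
    rw [Finset.sum_eq_single i]
    · simp [pairing]
    · intro i' _ hi
      change (∫ ω, (Matrix.diagonal v i i' : Lp ℂ 1 μ) ω * x a b ω ∂μ) * h (b, i') = 0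
      rw [Matrix.diagonal_apply_ne' _ hi, integral_eq_zero_of_ae, zero_mul]
      filter_upwards [Lp.coeFn_zero ℂ 1 μ] with ω hω
      rw [hω, Pi.zero_apply, zero_mul]
    · simp
  simp_rw [e]
  refine (sum_norm_sq_le_scalarNorm _ fun b => h (b, i)).trans ?_
  refine mul_le_of_le_one_left (by positivity) (pow_le_one₀ ENNReal.toReal_nonneg ?_)
  exact ENNReal.toReal_le_of_le_ofReal zero_le_one
    (by simpa using scalarNorm_integral_mul_le μ (v i) (hv i) x hx)

variable {H : Type*} [NormedAddCommGroup H] [InnerProductSpace ℂ H]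
  {E : Type*} [NormedAddCommGroup E] [NormedSpace ℂ E] (j : E →ₗᵢ[ℂ] (H →L[ℂ] H))

theorem norm_inv_norm_smul_le {V : Type*} [NormedAddCommGroup V] [NormedSpace ℂ V] (v : V) :
    ‖((‖v‖⁻¹ : ℝ) : ℂ) • v‖ ≤ 1 := by
  rw [norm_smul, Complex.norm_real, norm_inv, norm_norm]
  exact inv_mul_le_one

theorem norm_smul_inv_norm_smul {V : Type*} [NormedAddCommGroup V] [NormedSpace ℂ V] (v : V) :
    (‖v‖ : ℂ) • ((‖v‖⁻¹ : ℝ) : ℂ) • v = v := by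
  rcases eq_or_ne v 0 with rfl | hv
  · simp
  · rw [smul_smul, ← Complex.ofReal_mul, mul_inv_cancel₀ (norm_ne_zero_iff.2 hv)]
    simp

/-- On `1 × 1` matrices the operator space projective norm is at most the projective norm. -/
theorem projMatrixNorms_one_sum_tmul_le {p : ℕ} (f : Fin p → Lp ℂ 1 μ) (e : Fin p → E) :
    projMatrixNorms (loneMatrixNorms μ) (spaceMatrixNorms j) 1
      (Matrix.of fun _ _ => ∑ i, f i ⊗ₜ[ℂ] e i) ≤ ENNReal.ofReal (∑ i, ‖f i‖ * ‖e i‖) := by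
  let t : Fin p → ℝ := fun i => ‖f i‖ * ‖e i‖
  have ht : ∀ i, 0 ≤ t i := fun i => by positivity
  -- The row `α` and the column `αᵀ` pick out the diagonal pairs `(i, i)` with weight `√(t i)`; `v`
  -- and `w` are the normalized entries placed on diagonals. Each scalar factor has Hilbert–Schmidt
  -- norm `√(∑ t i)`, and the two multiply to `∑ t i`. Zero vectors cause no trouble, as `0⁻¹ = 0`.
  let α : Matrix (Fin 1) (Fin p × Fin p) ℂ :=
    Matrix.of fun _ r => if r.1 = r.2 then (√(t r.1) : ℂ) else 0
  let v : Fin p → Lp ℂ 1 μ := fun i => ((‖f i‖⁻¹ : ℝ) : ℂ) • f i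
  let w : Fin p → E := fun i => ((‖e i‖⁻¹ : ℝ) : ℂ) • e i
  have hα : ∑ i, ∑ r, ‖α i r‖ ^ 2 = ∑ i, t i := by
    simp only [Finset.univ_unique, Finset.sum_singleton, Fintype.sum_prod_type]
    refine Finset.sum_congr rfl fun i _ => ?_
    rw [Finset.sum_eq_single i]
    · simp [α, Real.sq_sqrt (ht i)]
    · intro b _ hb
      simp [α, hb.symm]
    · simp
  have hα1 : scalarNorm α ≤ ENNReal.ofReal √(∑ i, t i) := by
    rw [← hα]; exact scalarNorm_le_sqrt α
  have hβ1 : scalarNorm α.transpose ≤ ENNReal.ofReal √(∑ i, t i) := by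
    rw [← hα, Finset.sum_comm]; exact scalarNorm_le_sqrt α.transpose
  refine (?_ : _ ≤ scalarNorm α * loneMatrixNorms μ p (Matrix.diagonal v) *
    spaceMatrixNorms j p (Matrix.diagonal w) * scalarNorm α.transpose).trans ?_
  · refine iInf_le_of_le p <| iInf_le_of_le p <| iInf_le_of_le α <| iInf_le_of_le _ <|
      iInf_le_of_le _ <| iInf_le_of_le _ <| iInf_le_of_le ?_ le_rfl
    intro a b
    simp only [Matrix.of_apply, Fintype.sum_prod_type]
    refine Finset.sum_congr rfl fun i _ => ?_
    rw [Finset.sum_eq_single i, Finset.sum_eq_single i, Finset.sum_eq_single i]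
    · simp only [α, Matrix.transpose_apply, Matrix.of_apply, if_true, Matrix.diagonal_apply_eq]
      rw [← Complex.ofReal_mul, Real.mul_self_sqrt (ht i), Complex.ofReal_mul,
        ← TensorProduct.smul_tmul_smul]
      simp only [v, w, norm_smul_inv_norm_smul]
    · intro k _ hk
      simp [α, hk.symm]
    · simp
    · intro k _ hk
      simp [Matrix.diagonal_apply_ne' _ hk]
    · simp
    · intro k _ hk
      simp [α, hk.symm]
    · simp
  · calc _ ≤ ENNReal.ofReal √(∑ i, t i) * 1 * 1 * ENNReal.ofReal √(∑ i, t i) := by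
          gcongr
          · exact loneMatrixNorms_diagonal_le μ v fun i => norm_inv_norm_smul_le _
          · exact opMatrixNorm_diagonal_le j w fun i => norm_inv_norm_smul_le _
      _ = _ := by
          rw [mul_one, mul_one, ← ENNReal.ofReal_mul (Real.sqrt_nonneg _),
            Real.mul_self_sqrt (Finset.sum_nonneg fun i _ => ht i)]

/-- The level sets of `s` are disjoint, so writing `s` as the sum of `1_{s = x} ⊗ x` over its values
costs `∑ μ(s = x) ‖x‖`, which is exactly the `L^1` norm. -/
theorem exists_tensorToLp_eq_simpleFunc [IsFiniteMeasure μ] (s : Lp.simpleFunc E 1 μ) :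
    ∃ u : Lp ℂ 1 μ ⊗[ℂ] E, tensorToLp μ u = s ∧
      projMatrixNorms (loneMatrixNorms μ) (spaceMatrixNorms j) 1 (Matrix.of fun _ _ => u) ≤
        ENNReal.ofReal ‖s‖ := by
  let S := Lp.simpleFunc.toSimpleFunc s
  let ε := S.range.equivFin.symm
  let f : Fin S.range.card → Lp ℂ 1 μ := fun i =>
    indicatorConstLp 1 (S.measurableSet_fiber (ε i : E)) (measure_ne_top μ _) 1
  let e : Fin S.range.card → E := fun i => ε i
  refine ⟨∑ i, f i ⊗ₜ[ℂ] e i, ?_, (projMatrixNorms_one_sum_tmul_le μ j f e).trans_eq ?_⟩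
  · rw [map_sum]
    apply Lp.ext
    have h1 : ∀ᵐ ω ∂μ, ∀ i, tensorToLp μ (f i ⊗ₜ[ℂ] e i) ω =
        (S ⁻¹' {(ε i : E)}).indicator (fun _ => (ε i : E)) ω := by
      rw [ae_all_iff]
      intro i
      filter_upwards [tensorToLp_tmul μ (f i) (e i), indicatorConstLp_coeFn
        (hs := S.measurableSet_fiber (ε i : E)) (hμs := measure_ne_top μ _) (c := (1 : ℂ))
        (p := 1)] with ω h1 h2
      rw [h1]
      change (indicatorConstLp 1 _ _ (1 : ℂ) : Lp ℂ 1 μ) ω • (ε i : E) = _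
      rw [h2]
      by_cases h : ω ∈ S ⁻¹' {(ε i : E)} <;> simp [h]
    have h2 := Lp.coeFn_finsetSum Finset.univ fun i => tensorToLp μ (f i ⊗ₜ[ℂ] e i)
    filter_upwards [h1, h2, Lp.simpleFunc.toSimpleFunc_eq_toFun s] with ω h1 h2 h3
    rw [h2, Finset.sum_apply, ← h3]
    simp_rw [h1]
    rw [Finset.sum_eq_single (ε.symm ⟨S ω, S.mem_range_self ω⟩)]
    · simp [S]
    · intro i _ hi
      refine Set.indicator_of_notMem (fun h => hi ?_) _
      rw [Equiv.eq_symm_apply]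
      exact Subtype.ext h.symm
    · simp
  · congr 1
    rw [L1.SimpleFunc.norm_eq_sum_mul]
    refine Eq.trans ?_ (Finset.sum_coe_sort S.range fun x => μ.real (S ⁻¹' {x}) * ‖x‖)
    rw [← ε.sum_comp]
    refine Finset.sum_congr rfl fun i _ => ?_
    simp [f, e, S, norm_indicatorConstLp]

theorem denseRange_tensorToLp [IsFiniteMeasure μ] (j : E →ₗᵢ[ℂ] (H →L[ℂ] H)) :
    DenseRange (tensorToLp μ : Lp ℂ 1 μ ⊗[ℂ] E →ₗ[ℂ] Lp E 1 μ) := by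
  refine (Lp.simpleFunc.denseRange (E := E) (μ := μ) ENNReal.one_ne_top).mono ?_
  rintro _ ⟨s, rfl⟩
  exact (exists_tensorToLp_eq_simpleFunc μ j s).imp fun _ h => h.1

theorem bochnerMatrixNorms_one_le [IsFiniteMeasure μ] (f : Lp E 1 μ) :
    bochnerMatrixNorms μ j 1 (Matrix.of fun _ _ => f) ≤ ‖f‖ₑ := by
  refine le_of_forall_gt fun b hb => ?_
  obtain ⟨c, hfc, hcb⟩ := exists_between hb
  -- A liminf is bounded by `c` once the values are frequently at most `c`: each neighbourhood of
  -- `f` contains simple functions of norm below `c`.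
  refine (liminf_le_of_frequently_le' ?_).trans_lt hcb
  rw [frequently_comap, frequently_iff]
  intro U hU
  have h1 : ∀ᶠ g in 𝓝 f, (Matrix.of fun _ _ => g : Matrix (Fin 1) (Fin 1) (Lp E 1 μ)) ∈ U :=
    (continuous_matrix fun _ _ => continuous_id).tendsto f hU
  have h2 : ∀ᶠ g in 𝓝 f, ‖g‖ₑ < c := continuous_enorm.tendsto f (Iio_mem_nhds hfc)
  obtain ⟨_, ⟨s, rfl⟩, hgU, hgc⟩ :=
    (Lp.simpleFunc.denseRange (E := E) (μ := μ) ENNReal.one_ne_top).inter_nhds_nonempty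
      (h1.and h2)
  obtain ⟨u, hu, hus⟩ := exists_tensorToLp_eq_simpleFunc μ j s
  refine ⟨_, hgU, Matrix.of fun _ _ => u, ?_, hus.trans ?_⟩
  · ext1
    simp [hu]
  · rw [ofReal_norm]
    exact hgc.le

end Lebesgue

/-! ### The trivial representation -/

section Dual

variable (G : Type*) [Group G] [TopologicalSpace G]

/-- The trivial representation on `ℂ`. -/
def trivialRep : IrrUnitaryRep G where
  deg := 1
  hom := 1
  continuous_hom := continuous_const
  irreducible :=
    have h : IsSimpleOrder (Submodule ℂ (Fin 1 → ℂ)) :=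
      is_simple_module_of_finrank_eq_one (Module.finrank_fin_fun ℂ)
    { exists_pair_ne := ⟨⊥, ⊤, fun h0 =>
        bot_ne_top (α := Submodule ℂ (Fin 1 → ℂ)) (congrArg Subrepresentation.toSubmodule h0)⟩
      eq_bot_or_eq_top := fun S => (h.eq_bot_or_eq_top S.toSubmodule).imp
        (fun hS => Subrepresentation.toSubmodule_injective hS)
        (fun hS => Subrepresentation.toSubmodule_injective hS) }

variable {G}

/-- The representative `rep` chosen in the trivial class need not be `trivialRep` itself, so its
properties are transported along the intertwiner. -/
theorem mat_eq_one_of_equiv_trivialRep {π : IrrUnitaryRep G}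
    (h : unitaryEquiv G π (trivialRep G)) (g : G) : π.mat g = 1 := by
  obtain ⟨U, h1, -, h2⟩ := h
  calc π.mat g = U.conjTranspose * U * π.mat g := by rw [h1, Matrix.one_mul]
    _ = U.conjTranspose * U := by
      rw [Matrix.mul_assoc, h2 g, show (trivialRep G).mat g = 1 from rfl, Matrix.one_mul]
    _ = 1 := h1

theorem deg_pos_of_equiv_trivialRep {π : IrrUnitaryRep G}
    (h : unitaryEquiv G π (trivialRep G)) : 0 < π.deg := by
  obtain ⟨U, -, h1, -⟩ := h
  by_contra h0
  have : IsEmpty (Fin π.deg) := by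
    rw [Nat.eq_zero_of_not_pos h0]; infer_instance
  have h2 := congrFun (congrFun h1 (0 : Fin 1)) (0 : Fin 1)
  have h3 : (U * U.conjTranspose) (0 : Fin 1) (0 : Fin 1) = 0 :=
    Matrix.mul_apply.trans (Finset.sum_of_isEmpty _)
  exact zero_ne_one (h3.symm.trans h2)

end Dual

/-! ### The Fourier transform: uniqueness and the lower bound -/

section Fourier

variable {G : Type*} [Group G] [TopologicalSpace G] [MeasurableSpace G] (μ : Measure G)
  {rep : DualObject G → IrrUnitaryRep G}
  {H : Type*} [NormedAddCommGroup H] [InnerProductSpace ℂ H]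
  {E : Type*} [NormedAddCommGroup E] [NormedSpace ℂ E]
  {j : E →ₗᵢ[ℂ] (H →L[ℂ] H)}

theorem opMatrixNorm_apply_le_fourierCbNorm [IsFiniteMeasure μ]
    (Λ : Lp E 1 μ →ₗ[ℂ] dualLinfty rep j) {f : Lp E 1 μ} (hf : ‖f‖ ≤ 1) (π : DualObject G) :
    opMatrixNorm j ((Λ f).1 π) ≤ fourierCbNorm μ Λ := by
  have hF : bochnerMatrixNorms μ j 1 (Matrix.of fun _ _ => f) ≤ 1 := by
    refine (bochnerMatrixNorms_one_le μ j f).trans ?_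
    rwa [← ofReal_norm, ENNReal.ofReal_le_one]
  calc opMatrixNorm j ((Λ f).1 π)
      ≤ dualLinftyMatrixNorms rep j 1 ((Matrix.of fun _ _ => f).map Λ) :=
        (opMatrixNorm_le_comp_of_unique j (κ := Fin 1) _).trans (le_iSup_of_le π le_rfl)
    _ ≤ _ := le_iSup_of_le (f := fun n => ⨆ (x : Matrix (Fin n) (Fin n) (Lp E 1 μ))
        (_ : bochnerMatrixNorms μ j n x ≤ 1), dualLinftyMatrixNorms rep j n (x.map Λ)) 1
        (le_iSup₂_of_le _ hF le_rfl)

/-- A finite cb norm bounds each entry on the unit ball of the Bochner norm, by the comparison on `1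
× 1` matrices. -/
theorem continuous_apply_of_fourierCbNorm_lt_top [IsFiniteMeasure μ]
    {Λ : Lp E 1 μ →ₗ[ℂ] dualLinfty rep j} (hΛ : fourierCbNorm μ Λ < ∞) (π : DualObject G)
    (i k : Fin (rep π).deg) : Continuous fun f => (Λ f).1 π i k := by
  let T : Lp E 1 μ →ₗ[ℂ] E := Matrix.entryLinearMap ℂ E i k ∘ₗ LinearMap.proj π ∘ₗ
    (dualLinfty rep j).subtype ∘ₗ Λ
  have hT : ∀ f ∈ Metric.ball (0 : Lp E 1 μ) 1, ‖T f‖ ≤ (fourierCbNorm μ Λ).toReal := fun f hf => by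
    refine (ENNReal.ofReal_le_iff_le_toReal hΛ.ne).1 ?_
    rw [ofReal_norm]
    exact (enorm_apply_le_opMatrixNorm j _ i k).trans
      (opMatrixNorm_apply_le_fourierCbNorm μ Λ (mem_ball_zero_iff.1 hf).le π)
  obtain ⟨C, hC⟩ := T.bound_of_ball_bound zero_lt_one _ hT
  exact (T.mkContinuous C hC).continuous

variable [BorelSpace G] [CompleteSpace E]
variable (rep j)

theorem opMatrixNorm_fourierCoeff_le [IsFiniteMeasure μ] (π : IrrUnitaryRep G) (f : Lp E 1 μ) :
    opMatrixNorm j (fourierCoeff μ π f) ≤ ‖f‖ₑ :=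
  (opMatrixNorm_le_comp_of_unique j (κ := Fin 1) _).trans <|
    (opMatrixNorm_fourierCoeff_le_bochnerMatrixNorms μ j π (Matrix.of fun _ _ => f)).trans <|
      bochnerMatrixNorms_one_le μ j f

/-- The Fourier transform `L^1_E(G) → 𝓛^∞_E(Ĝ)`. -/
def fourierTransform [IsFiniteMeasure μ] : Lp E 1 μ →ₗ[ℂ] dualLinfty rep j :=
  (LinearMap.pi fun π => fourierCoeffₗ μ (rep π)).codRestrict (dualLinfty rep j) fun f =>
    (iSup_le fun π => opMatrixNorm_fourierCoeff_le μ j (rep π) f).trans_lt enorm_lt_top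

theorem fourierCbNorm_fourierTransform_le [IsFiniteMeasure μ] :
    fourierCbNorm μ (fourierTransform μ rep j) ≤ 1 :=
  iSup_le fun _ => iSup₂_le fun F hF => iSup_le fun π =>
    (opMatrixNorm_fourierCoeff_le_bochnerMatrixNorms μ j (rep π) F).trans hF

variable {rep j}

/-- Both maps agree on elementary tensors, hence on the image of `L^1 ⊗ E`, which is dense, and both
have continuous entries. -/
theorem IsCbFourierExtension.eq_fourierTransform [IsFiniteMeasure μ]
    {Λ : Lp E 1 μ →ₗ[ℂ] dualLinfty rep j} (hΛ : IsCbFourierExtension μ Λ) :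
    Λ = fourierTransform μ rep j := by
  ext f π i k
  refine congrFun ((denseRange_tensorToLp μ j).equalizer
    (continuous_apply_of_fourierCbNorm_lt_top μ hΛ.2 π i k)
    ((continuous_fourierCoeff μ (rep π)).matrix_elem i k) (funext fun u => ?_)) f
  have h : Λ ∘ₗ tensorToLp μ = fourierTransform μ rep j ∘ₗ tensorToLp μ := by
    refine TensorProduct.ext' fun f e => Subtype.ext (funext fun π => ?_)
    refine (hΛ.1 f e π).trans (fourierCoeff_tensorToLp μ (rep π) f e).symm
  exact congrArg (fun A : dualLinfty rep j => A.1 π i k) (LinearMap.congr_fun h u)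

theorem one_le_fourierCbNorm_fourierTransform [IsProbabilityMeasure μ] [Nontrivial E]
    (hrep : ∀ π, Quotient.mk (unitaryEquiv G) (rep π) = π) :
    1 ≤ fourierCbNorm μ (fourierTransform μ rep j) := by
  obtain ⟨e, he⟩ := exists_norm_eq E zero_le_one
  let π : DualObject G := Quotient.mk (unitaryEquiv G) (trivialRep G)
  have hπ : unitaryEquiv G (rep π) (trivialRep G) := Quotient.exact (hrep π)
  let i : Fin (rep π).deg := ⟨0, deg_pos_of_equiv_trivialRep hπ⟩
  -- Since `μ` has mass one, the constant function `e` has norm at most 1, and its diagonal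
  -- coefficient at the trivial class is `e`.
  let f : Lp E 1 μ := Lp.const 1 μ e
  have hf : ‖f‖ ≤ 1 := (Lp.norm_const_le 1 μ e).trans (by simp [he])
  have h : fourierCoeff μ (rep π) f i i = e := by
    have : ∀ᵐ g ∂μ, ((rep π).mat g).conjTranspose i i • f g = e := by
      filter_upwards [Lp.coeFn_const 1 μ e] with g hg
      rw [mat_eq_one_of_equiv_trivialRep hπ, hg]
      simp
    rw [fourierCoeff, Matrix.of_apply, integral_congr_ae this]
    simp
  calc 1 = ‖fourierCoeff μ (rep π) f i i‖ₑ := by rw [h, ← ofReal_norm, he, ENNReal.ofReal_one]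
    _ ≤ _ := enorm_apply_le_opMatrixNorm j _ i i
    _ ≤ _ := opMatrixNorm_apply_le_fourierCbNorm μ (fourierTransform μ rep j) hf π

end Fourier

end FourierType

end

theorem mainTheorem7 {G : Type*} [Group G] [TopologicalSpace G] [IsTopologicalGroup G]
    [CompactSpace G] [T2Space G] [MeasurableSpace G] [BorelSpace G]
    (μ : Measure G) [μ.IsHaarMeasure] [μ.Regular] [IsProbabilityMeasure μ]
    (rep : FourierType.DualObject G → FourierType.IrrUnitaryRep G)
    (hrep : ∀ π, Quotient.mk (FourierType.unitaryEquiv G) (rep π) = π)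
    {H : Type*} [NormedAddCommGroup H] [InnerProductSpace ℂ H] [CompleteSpace H]
    {E : Type*} [NormedAddCommGroup E] [NormedSpace ℂ E] [CompleteSpace E] [Nontrivial E]
    (j : E →ₗᵢ[ℂ] (H →L[ℂ] H)) :
    ∃ Λ : Lp E 1 μ →ₗ[ℂ] FourierType.dualLinfty rep j,
      FourierType.IsCbFourierExtension μ Λ ∧
      (∀ Λ' : Lp E 1 μ →ₗ[ℂ] FourierType.dualLinfty rep j,
        FourierType.IsCbFourierExtension μ Λ' → Λ' = Λ) ∧
      (∀ (f : Lp E 1 μ) (π : FourierType.DualObject G),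
        (Λ f).1 π = FourierType.fourierCoeff μ (rep π) f) ∧
      FourierType.fourierCbNorm μ Λ = 1 := by
  have hle := FourierType.fourierCbNorm_fourierTransform_le μ rep j
  exact ⟨FourierType.fourierTransform μ rep j,
    ⟨fun f e π => FourierType.fourierCoeff_tensorToLp μ (rep π) f e,
      hle.trans_lt ENNReal.one_lt_top⟩,
    fun Λ' h => h.eq_fourierTransform μ, fun _ _ => rfl,
    hle.antisymm (FourierType.one_le_fourierCbNorm_fourierTransform μ hrep)⟩
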